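/- Let $0<\alpha<2\pi$ and let $\mathcal C_\alpha\subset\mathbb R^3$ be the finite circular cone with generator of length $1$, with its tip at the origin removed, whose isometric unrolling is the planar circular sector of radius $1$ and opening angle $\alpha$; that is, the angle $\beta$ between axis and generator satisfies $\sin\beta=\alpha/2\pi$. Equip $\mathcal C_\alpha$ with the metric induced by $\mathbb R^3$ and its surface measure $dS$. Let $H^1(\mathcal C_\alpha;T\mathcal C_\alpha)$ be the space of square integrable tangent vector fields $u$ on $\mathcal C_\alpha$ whose weak covariant derivative $Du$ satisfies $\int_{\mathcal C_\alpha}|Du|^2\,dS<\infty$. Let $s>1/2$, let $g$ be a unit tangent vector field of class $H^s$ along the boundary circle $\partial\mathcal C_\alpha=\{x\in\mathcal C_\alpha:|x|=1\}$, and let $$H^1_g:=\{u\in H^1(\mathcal C_\alpha;T\mathcal C_\alpha): u|_{\partial\mathcal C_\alpha}=g\},$$ the boundary values being taken in the sense of traces. If $u\in H^1_g$, then $|u|$ is not bounded away from zero on any punctured ball centered at the tip: for every $r>0$ there is no $\gamma>0$ such that $|u(x)|\ge\gamma$ for $dS$-almost every $x\in\mathcal C_\alpha$ with $\operatorname{dist}_{\mathcal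 C_\alpha}(x,0)<r$, where $\operatorname{dist}_{\mathcal C_\alpha}$ is the geodesic distance on $\mathcal C_\alpha\cup\{0\}$. -/

import Mathlib

open MeasureTheory Set
open scoped ENNReal ContDiff

noncomputable section

/-- Ambient Euclidean space `ℝ³`. -/
abbrev E3 : Type := EuclideanSpace ℝ (Fin 3)

/-- The finite circular cone with generator of length `1` and with its tip (the origin) removed.
The angle `β` between the axis and a generator satisfies `sin β = α / 2π`, so that the boundary
circle has length `α` and the cone unrolls to a planar sector of opening angle `α`. -/
def cone (α : ℝ) : Set E3 :=
  {x | 0 < ‖x‖ ∧ ‖x‖ ≤ 1 ∧ x 2 = √(1 - (α / (2 * Real.pi)) ^ 2) * ‖x‖}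

/-- The inverse of the unrolling of the cone onto the sector, in polar coordinates `(r, θ)`;
it is a local isometry from `dr² + r² dθ²`, and `α`-periodic in `θ`. -/
def conePoint (α : ℝ) (p : ℝ × ℝ) : E3 :=
  !₂[p.1 * (α / (2 * Real.pi) * Real.cos (2 * Real.pi * p.2 / α)),
     p.1 * (α / (2 * Real.pi) * Real.sin (2 * Real.pi * p.2 / α)),
     p.1 * √(1 - (α / (2 * Real.pi)) ^ 2)]

/-- Surface measure on the cone: the image of `r dr dθ` on `(0,1) × (0,α)`. -/
def coneMeasure (α : ℝ) : Measure E3 :=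
  Measure.map (conePoint α)
    ((volume.restrict (Ioo (0 : ℝ) 1 ×ˢ Ioo (0 : ℝ) α)).withDensity
      fun p => ENNReal.ofReal p.1)

/-- The unit vector field along the generators of the cone. -/
def coneN (x : E3) : E3 := ‖x‖⁻¹ • x

/-- The unit vector field along the circles of latitude of the cone. -/
def coneT (x : E3) : E3 := (√(x 0 ^ 2 + x 1 ^ 2))⁻¹ • !₂[-x 1, x 0, 0]

/-- The tangent plane at a point `x` of the cone. -/
def coneTangentSpace (x : E3) : Submodule ℝ E3 := Submodule.span ℝ {coneN x, coneT x}

/-- Geodesic distance on the cone with its tip added: the infimum of the lengths of the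
curves that join two points within it. -/
def coneDist (α : ℝ) (x y : E3) : ℝ≥0∞ :=
  ⨅ (c : ℝ → E3) (_ : ContinuousOn c (Icc 0 1)) (_ : c 0 = x) (_ : c 1 = y)
    (_ : ∀ t ∈ Icc (0 : ℝ) 1, c t ∈ insert 0 (cone α)), eVariationOn c (Icc 0 1)

/-- The geodesic ball `B_r(a)`, as a subset of the cone without its tip
(so for `a = 0` this is a punctured ball). -/
def coneBall (α : ℝ) (a : E3) (r : ℝ) : Set E3 :=
  {x | x ∈ cone α ∧ coneDist α x a < ENNReal.ofReal r}

/-- The strip `(0,1) × ℝ` of polar coordinates `(r, θ)`: the universal cover of the interior of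
the cone. -/
def strip : Set (ℝ × ℝ) := Ioo (0 : ℝ) 1 ×ˢ (univ : Set ℝ)

/-- `V` is the weak derivative of `U` on the strip in the coordinate direction `v`. -/
def IsWeakDeriv (v : ℝ × ℝ) (U V : ℝ × ℝ → E3) : Prop :=
  LocallyIntegrableOn U strip ∧ LocallyIntegrableOn V strip ∧
    ∀ φ : ℝ × ℝ → ℝ, ContDiff ℝ ∞ φ → HasCompactSupport φ → tsupport φ ⊆ strip →
      ∫ p in strip, fderiv ℝ φ p v • U p = -∫ p in strip, φ p • V p

/-- `|Du|²` at the point with polar coordinates `p = (r, θ)`, given the partial derivatives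
`Ur`, `Uθ` there of a tangent field `u` (as an `ℝ³`-valued function of `(r, θ)`). The covariant
derivative is the orthogonal projection of the ambient derivative onto the tangent plane, and the
unit vectors `N`, `T` are `∂_r`, `r⁻¹ ∂_θ`. -/
def covDerivNormSq (α : ℝ) (p : ℝ × ℝ) (Ur Uθ : E3) : ℝ :=
  ‖(coneTangentSpace (conePoint α p)).starProjection Ur‖ ^ 2 +
    ‖p.1⁻¹ • (coneTangentSpace (conePoint α p)).starProjection Uθ‖ ^ 2

/-- The space `H¹` of tangent vector fields on the cone: square integrable tangent fields with a
square integrable weak covariant derivative. (Values of `u` off the cone play no role. Test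
functions live on the universal cover, so the generator `θ = 0` is not singled out.) -/
structure MemH1 (α : ℝ) (u : E3 → E3) : Prop where
  tangent : ∀ᵐ x ∂coneMeasure α, u x ∈ coneTangentSpace x
  memLp : MemLp u 2 (coneMeasure α)
  weakDeriv : ∃ Ur Uθ : ℝ × ℝ → E3,
    IsWeakDeriv (1, 0) (u ∘ conePoint α) Ur ∧ IsWeakDeriv (0, 1) (u ∘ conePoint α) Uθ ∧
      ∫⁻ p in Ioo (0 : ℝ) 1 ×ˢ Ioo (0 : ℝ) α,
        ENNReal.ofReal (covDerivNormSq α p (Ur p) (Uθ p) * p.1) < ⊤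

/-- `g` is the trace of `u` on the boundary circle `r = 1`, expressed by Green's formula
with test functions that need not vanish there. -/
def HasTrace (α : ℝ) (u g : E3 → E3) : Prop :=
  ∃ Ur : ℝ × ℝ → E3, IsWeakDeriv (1, 0) (u ∘ conePoint α) Ur ∧
    ∀ φ : ℝ × ℝ → ℝ, ContDiff ℝ ∞ φ → HasCompactSupport φ →
      tsupport φ ⊆ Ioi (0 : ℝ) ×ˢ (univ : Set ℝ) →
      ∫ p in strip, (fderiv ℝ φ p (1, 0) • u (conePoint α p) + φ p • Ur p) =
        ∫ θ : ℝ, φ (1, θ) • g (conePoint α (1, θ))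

/-- `g` is a unit tangent vector field along the boundary circle, of class `H^s`
(in terms of Fourier coefficients with respect to the arc length `θ ∈ ℝ / αℤ`). -/
structure MemHsUnitTangent (α s : ℝ) (g : E3 → E3) : Prop where
  meas : AEStronglyMeasurable (fun θ : ℝ => g (conePoint α (1, θ)))
  tangent : ∀ᵐ θ : ℝ, g (conePoint α (1, θ)) ∈ coneTangentSpace (conePoint α (1, θ))
  unit : ∀ᵐ θ : ℝ, ‖g (conePoint α (1, θ))‖ = 1
  fourier : ∀ i : Fin 3, Summable fun n : ℤ =>
    (1 + (n : ℝ) ^ 2) ^ s *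
      ‖∫ θ in (0 : ℝ)..α, Complex.exp (-(2 * Real.pi * Complex.I * n * θ / α)) *
        ((g (conePoint α (1, θ)) i : ℝ) : ℂ)‖ ^ 2

/-- The class `H¹_g` of tangent vector fields in `H¹` that equal `g` on the boundary circle. -/
def H1g (α : ℝ) (g : E3 → E3) : Set (E3 → E3) := {u | MemH1 α u ∧ HasTrace α u g}

end

noncomputable section

/-! The obstruction is the holonomy of the cone. In the unrolled sector a parallel field is
constant, but its angle to the generator changes by `α` on the way once round the tip, and for `0 <
α < 2π` this rotation moves every tangent vector `v` by exactly `√(2 - 2 cos α) ‖v‖`, a positive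
multiple of its length (`holonomy_le`). The field `u` is single valued, so its components in a
parallel frame must change by that amount along each circle of latitude, and only the covariant
angular derivative can produce the change (`ae_holonomy_le_arc`).

If `|u| ≥ γ` near the tip, then on almost every small circle the integral of `|D_θ u|` over `θ` has
a lower bound independent of `r`, and hence so has that of `|D_θ u|²`. The energy contains `|r⁻¹ D_θ
u|² r = r⁻¹ |D_θ u|²`, so it dominates a multiple of `∫ dr / r`, which diverges at `0`
(`lintegral_energy_eq_top`). This contradicts `u ∈ H¹`.

The change along arcs is extracted directly from the weak derivative: testing with the angular
primitive of `φ`, whose angular derivative is the difference of `φ` and its translate by `α`, gives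
the fundamental theorem of calculus over length `α` almost everywhere
(`IsWeakAngularDeriv.ae_sub_eq_integral`). -/

/-! ### Angular translation and averaging on the strip -/

theorem isOpen_strip : IsOpen strip := isOpen_Ioo.prod isOpen_univ

theorem add_angle_mem_strip {p : ℝ × ℝ} (hp : p ∈ strip) (t : ℝ) : p + (0, t) ∈ strip := by
  simpa [strip] using hp

/-- The set swept out by `K` under the rotations by an angle in `[0, α]`. -/
def sweep (α : ℝ) (K : Set (ℝ × ℝ)) : Set (ℝ × ℝ) :=
  (fun q : (ℝ × ℝ) × ℝ => q.1 + (0, q.2)) '' (K ×ˢ Icc 0 α)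

theorem IsCompact.sweep {K : Set (ℝ × ℝ)} (hK : IsCompact K) (α : ℝ) : IsCompact (sweep α K) :=
  (hK.prod isCompact_Icc).image (by fun_prop)

theorem sweep_subset_strip {K : Set (ℝ × ℝ)} (hK : K ⊆ strip) (α : ℝ) : sweep α K ⊆ strip := by
  rintro _ ⟨⟨p, t⟩, ⟨hp, -⟩, rfl⟩
  exact add_angle_mem_strip (hK hp) t

theorem add_mem_sweep {K : Set (ℝ × ℝ)} {α t : ℝ} {p : ℝ × ℝ} (hp : p ∈ K) (ht : t ∈ Icc 0 α) :
    p + (0, t) ∈ sweep α K :=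
  ⟨(p, t), ⟨hp, ht⟩, rfl⟩

/-- The translates of an integrable function in the angular direction are jointly integrable. -/
theorem integrable_translate_angle {h : ℝ × ℝ → ℝ} (hh : Integrable h) (α : ℝ) :
    Integrable (fun q : ℝ × (ℝ × ℝ) => h (q.2 + (0, q.1)))
      ((volume.restrict (Ioc 0 α)).prod volume) := by
  -- The shear `(t, p) ↦ (t, p + (0, t))` preserves the product measure.
  have hmp : MeasurePreserving (fun q : ℝ × (ℝ × ℝ) => (q.1, q.2 + ((0 : ℝ), q.1)))
      ((volume.restrict (Ioc 0 α)).prod volume) ((volume.restrict (Ioc 0 α)).prod volume) :=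
    MeasurePreserving.skew_product (MeasurePreserving.id _)
      (g := fun t p => p + ((0 : ℝ), t)) (by fun_prop)
      (Filter.Eventually.of_forall fun t => map_add_right_eq_self _ _)
  exact hmp.integrable_comp_of_integrable (hh.comp_snd (volume.restrict (Ioc 0 α)))

theorem MeasureTheory.LocallyIntegrableOn.integrable_indicator_strip {f : ℝ × ℝ → ℝ}
    (hf : LocallyIntegrableOn f strip) {K : Set (ℝ × ℝ)} (hK : IsCompact K) (hKs : K ⊆ strip) :
    Integrable (K.indicator f) :=
  (integrable_indicator_iff hK.measurableSet).2 (hf.integrableOn_compact_subset hKs hK)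

theorem MeasureTheory.LocallyIntegrableOn.comp_add_angle {f : ℝ × ℝ → ℝ} (hf : LocallyIntegrableOn f strip)
    (a : ℝ) : LocallyIntegrableOn (fun p => f (p + (0, a))) strip := by
  rw [locallyIntegrableOn_iff (isOpen_strip.isLocallyClosed)]
  intro K hKs hK
  set K' : Set (ℝ × ℝ) := (fun p => p + (0, a)) '' K
  have hK' : IsCompact K' := hK.image (by fun_prop)
  have hK's : K' ⊆ strip := by
    rintro _ ⟨p, hp, rfl⟩
    exact add_angle_mem_strip (hKs hp) a
  have h1 := (hf.integrable_indicator_strip hK' hK's).comp_add_right (0, a)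
  refine h1.integrableOn.congr_fun (fun p hp => ?_) hK.measurableSet
  exact indicator_of_mem (mem_image_of_mem _ hp) f

/-- On a compact `K` the average sees `h` only on the compact set swept out by `K`, so `h` may be
truncated there and Fubini applies. -/
theorem MeasureTheory.LocallyIntegrableOn.integral_angle {h : ℝ × ℝ → ℝ} (hh : LocallyIntegrableOn h strip)
    {α : ℝ} (hα : 0 ≤ α) :
    LocallyIntegrableOn (fun p => ∫ t in (0 : ℝ)..α, h (p + (0, t))) strip := by
  rw [locallyIntegrableOn_iff (isOpen_strip.isLocallyClosed)]
  intro K hKs hK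
  have h1 := (integrable_translate_angle (hh.integrable_indicator_strip (hK.sweep α)
    (sweep_subset_strip hKs α)) α).integral_prod_right
  refine h1.integrableOn.congr_fun (fun p hp => ?_) hK.measurableSet
  rw [intervalIntegral.integral_of_le hα]
  exact setIntegral_congr_fun measurableSet_Ioc fun t ht =>
    indicator_of_mem (add_mem_sweep hp (Ioc_subset_Icc_self ht)) h

/-! ### Angular primitives of test functions -/

/-- The angular primitive of a test function. -/
def angularPrimitive (α : ℝ) (φ : ℝ × ℝ → ℝ) (p : ℝ × ℝ) : ℝ :=
  ∫ t in (0 : ℝ)..α, φ (p - (0, t))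

/-- The primitive is the convolution in the angle, with `r` as a parameter, of `φ` with the
indicator of `(0, α]`. -/
theorem contDiff_angularPrimitive {α : ℝ} (hα : 0 ≤ α) {φ : ℝ × ℝ → ℝ} (hφ : ContDiff ℝ ∞ φ)
    (hc : HasCompactSupport φ) : ContDiff ℝ ∞ (angularPrimitive α φ) := by
  have h1 := contDiffOn_convolution_right_with_param (μ := volume) (𝕜 := ℝ) (n := ⊤)
    (f := (Ioc (0 : ℝ) α).indicator fun _ => (1 : ℝ)) (ContinuousLinearMap.lsmul ℝ ℝ)
    (g := fun r x => φ (r, x)) (s := univ) (k := Prod.snd '' tsupport φ) isOpen_univ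
    (hc.isCompact.image continuous_snd)
    (fun r x _ hx => by
      by_contra h
      exact hx ⟨(r, x), subset_tsupport _ h, rfl⟩)
    (((integrable_indicator_iff measurableSet_Ioc).2 (by simp)).locallyIntegrable)
    (hφ.contDiffOn)
  rw [univ_prod_univ, contDiffOn_univ] at h1
  convert h1 using 1
  ext p
  rw [angularPrimitive, intervalIntegral.integral_of_le hα, convolution_def,
    ← integral_indicator measurableSet_Ioc]
  refine integral_congr_ae (Filter.Eventually.of_forall fun t => ?_)
  by_cases ht : t ∈ Ioc 0 α <;> simp [ht, Prod.sub_def]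

theorem angularPrimitive_eq_zero {α : ℝ} (hα : 0 ≤ α) {φ : ℝ × ℝ → ℝ} {p : ℝ × ℝ}
    (hp : p ∉ sweep α (tsupport φ)) : angularPrimitive α φ p = 0 := by
  rw [angularPrimitive, intervalIntegral.integral_of_le hα]
  refine setIntegral_eq_zero_of_forall_eq_zero fun t ht => ?_
  by_contra h
  exact hp ⟨(p - (0, t), t), ⟨subset_tsupport _ h, Ioc_subset_Icc_self ht⟩, by simp⟩

/-- After the substitution `s = θ - t` the angle enters only through the limits of integration, `θ -
α` and `θ`. -/
theorem fderiv_angularPrimitive {α : ℝ} (hα : 0 ≤ α) {φ : ℝ × ℝ → ℝ} (hφ : ContDiff ℝ ∞ φ)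
    (hc : HasCompactSupport φ) (p : ℝ × ℝ) :
    fderiv ℝ (angularPrimitive α φ) p (0, 1) = φ p - φ (p - (0, α)) := by
  obtain ⟨r, θ⟩ := p
  have h1 : HasDerivAt (fun x => angularPrimitive α φ (r, x))
      (fderiv ℝ (angularPrimitive α φ) (r, θ) (0, 1)) θ :=
    (((contDiff_angularPrimitive hα hφ hc).differentiable (by simp)) (r, θ)).hasFDerivAt.comp_hasDerivAt
      θ ((hasDerivAt_const θ r).prodMk (hasDerivAt_id θ))
  have hcont : Continuous fun x => φ (r, x) := hφ.continuous.comp (by fun_prop)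
  have hint : ∀ a b, IntervalIntegrable (fun x => φ (r, x)) volume a b :=
    fun a b => hcont.intervalIntegrable a b
  have h2 : (fun x => angularPrimitive α φ (r, x)) =
      fun x => (∫ s in (0 : ℝ)..x, φ (r, s)) - ∫ s in (0 : ℝ)..(x - α), φ (r, s) := by
    ext x
    have := intervalIntegral.integral_comp_sub_left (a := 0) (b := α) (fun s => φ (r, s)) x
    simp only [angularPrimitive, Prod.mk_sub_mk, sub_zero] at this ⊢
    rw [this, intervalIntegral.integral_interval_sub_left (hint _ _) (hint _ _)]
  have h3 : HasDerivAt (fun x => angularPrimitive α φ (r, x)) (φ (r, θ) - φ (r, θ - α)) θ := by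
    rw [h2]
    refine (hcont.integral_hasStrictDerivAt 0 θ).hasDerivAt.sub ?_
    exact (hcont.integral_hasStrictDerivAt 0 (θ - α)).hasDerivAt.comp_sub_const θ α
  simpa using h1.unique h3

/-! ### The fundamental theorem of calculus along arcs -/

/-- `h` is the weak derivative of the scalar function `f` on the strip in the angular direction. -/
def IsWeakAngularDeriv (f h : ℝ × ℝ → ℝ) : Prop :=
  LocallyIntegrableOn f strip ∧ LocallyIntegrableOn h strip ∧
    ∀ φ : ℝ × ℝ → ℝ, ContDiff ℝ ∞ φ → HasCompactSupport φ → tsupport φ ⊆ strip →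
      ∫ p in strip, fderiv ℝ φ p (0, 1) * f p = -∫ p in strip, φ p * h p

/-- A function with a weak angular derivative on the strip satisfies the fundamental theorem of
calculus along almost every circular arc. -/
theorem IsWeakAngularDeriv.ae_sub_eq_integral {f h : ℝ × ℝ → ℝ} (H : IsWeakAngularDeriv f h)
    {α : ℝ} (hα : 0 ≤ α) :
    ∀ᵐ p : ℝ × ℝ, p ∈ strip →
      f (p + (0, α)) - f p = ∫ t in (0 : ℝ)..α, h (p + (0, t)) := by
  obtain ⟨hf, hh, hw⟩ := H
  suffices H : ∀ᵐ p : ℝ × ℝ, p ∈ strip →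
      f (p + (0, α)) - f p - ∫ t in (0 : ℝ)..α, h (p + (0, t)) = 0 by
    filter_upwards [H] with p hp hps using sub_eq_zero.1 (hp hps)
  refine isOpen_strip.ae_eq_zero_of_integral_contDiff_smul_eq_zero
    (((hf.comp_add_angle α).sub hf).sub (hh.integral_angle hα)) fun φ hφ hc hs => ?_
  -- `K` contains every `p + (0, t)` with `φ p ≠ 0` and `0 ≤ t ≤ α`. Cutting `f` and `h` off outside
  -- `K` changes none of the integrals and makes them integrable on the whole plane, where
  -- translation and Fubini are free.
  set K := sweep α (tsupport φ) with hK
  have hKc : IsCompact K := hc.isCompact.sweep α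
  have hKs : K ⊆ strip := sweep_subset_strip hs α
  have hφK : ∀ p, p ∉ K → φ p = 0 := fun p hp => by
    by_contra h0
    have h1 := add_mem_sweep (subset_tsupport _ h0) (left_mem_Icc.2 hα)
    rw [Prod.mk_zero_zero, add_zero] at h1
    exact hp h1
  have hφK' : ∀ p, p ∉ K → φ (p - (0, α)) = 0 := fun p hp => by
    by_contra h0
    exact hp (by simpa using add_mem_sweep (subset_tsupport _ h0) (right_mem_Icc.2 hα))
  set f' := K.indicator f with hf'
  set h' := K.indicator h with hh'
  have hf'i : Integrable f' := hf.integrable_indicator_strip hKc hKs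
  have hh'i : Integrable h' := hh.integrable_indicator_strip hKc hKs
  obtain ⟨M, hM⟩ := hc.exists_bound_of_continuous hφ.continuous
  have hφm : ∀ {g : ℝ × ℝ → ℝ}, Integrable g → Integrable fun p => φ p * g p := fun hg =>
    hg.bdd_mul hφ.continuous.aestronglyMeasurable (Filter.Eventually.of_forall hM)
  have hmul : ∀ {t : ℝ} (g : ℝ × ℝ → ℝ), t ∈ Icc 0 α → ∀ p,
      φ p * K.indicator g (p + (0, t)) = φ p * g (p + (0, t)) := fun g ht p => by
    by_cases hp : φ p = 0
    · simp [hp]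
    · rw [indicator_of_mem (add_mem_sweep (subset_tsupport _ hp) ht)]
  have hD : ∀ p, φ p • (f (p + (0, α)) - f p - ∫ t in (0 : ℝ)..α, h (p + (0, t))) =
      φ p * f' (p + (0, α)) - φ p * f' p - ∫ t in Ioc 0 α, φ p * h' (p + (0, t)) := fun p => by
    have e0 := hmul f (left_mem_Icc.2 hα) p
    have e1 : ∫ t in Ioc 0 α, φ p * h' (p + (0, t)) = φ p * ∫ t in Ioc 0 α, h (p + (0, t)) := by
      rw [← integral_const_mul]
      exact setIntegral_congr_fun measurableSet_Ioc fun t ht => hmul h (Ioc_subset_Icc_self ht) p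
    rw [Prod.mk_zero_zero, add_zero] at e0
    rw [hmul f (right_mem_Icc.2 hα), e0, e1, intervalIntegral.integral_of_le hα, smul_eq_mul]
    ring
  have hprod : Integrable (fun q : ℝ × (ℝ × ℝ) => φ q.2 * h' (q.2 + (0, q.1)))
      ((volume.restrict (Ioc 0 α)).prod volume) :=
    (integrable_translate_angle hh'i α).bdd_mul
      (hφ.continuous.comp continuous_snd).aestronglyMeasurable
      (Filter.Eventually.of_forall fun q => hM q.2)
  have hprod' : Integrable (fun q : ℝ × (ℝ × ℝ) => φ (q.2 - (0, q.1)) * h' q.2)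
      ((volume.restrict (Ioc 0 α)).prod volume) :=
    (hh'i.comp_snd (volume.restrict (Ioc 0 α))).bdd_mul
      (hφ.continuous.comp (by fun_prop)).aestronglyMeasurable
      (Filter.Eventually.of_forall fun q => hM _)
  have htr : ∀ (t : ℝ) (g : ℝ × ℝ → ℝ),
      ∫ p, φ p * g (p + (0, t)) = ∫ p, φ (p - (0, t)) * g p := fun t g => by
    rw [← integral_add_right_eq_self (fun p => φ (p - (0, t)) * g p) (((0 : ℝ), t) : ℝ × ℝ)]
    simp only [add_sub_cancel_right]
  -- Averaging forward along arcs is adjoint to the angular primitive: swap the integrals, move the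
  -- translation onto `φ`, swap back.
  have hlast : ∫ p, ∫ t in Ioc 0 α, φ p * h' (p + (0, t)) = ∫ p, angularPrimitive α φ p * h' p := by
    rw [← integral_integral_swap (f := fun t p => φ p * h' (p + (0, t))) hprod]
    simp_rw [htr]
    rw [integral_integral_swap (f := fun t p => φ (p - (0, t)) * h' p) hprod']
    refine integral_congr_ae (Filter.Eventually.of_forall fun p => ?_)
    simp only [angularPrimitive]
    rw [intervalIntegral.integral_of_le hα, integral_mul_const]
  have hsupp : ∀ p, p ∉ K → angularPrimitive α φ p = 0 := fun p hp => angularPrimitive_eq_zero hα hp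
  have hw' := hw _ (contDiff_angularPrimitive hα hφ hc)
    (HasCompactSupport.intro hKc hsupp)
    ((closure_minimal (Function.support_subset_iff'.2 hsupp) hKc.isClosed).trans hKs)
  simp_rw [fderiv_angularPrimitive hα hφ hc] at hw'
  have hw1 : ∫ p in strip, (φ p - φ (p - (0, α))) * f p =
      ∫ p, (φ p - φ (p - (0, α))) * f' p := by
    rw [setIntegral_eq_integral_of_forall_compl_eq_zero]
    · refine integral_congr_ae (Filter.Eventually.of_forall fun p => ?_)
      by_cases hp : p ∈ K
      · simp [hf', hp]
      · simp [hφK p hp, hφK' p hp]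
    · intro p hp
      have hp' : p ∉ K := fun h => hp (hKs h)
      simp [hφK p hp', hφK' p hp']
  have hw2 : ∫ p in strip, angularPrimitive α φ p * h p = ∫ p, angularPrimitive α φ p * h' p := by
    rw [setIntegral_eq_integral_of_forall_compl_eq_zero]
    · refine integral_congr_ae (Filter.Eventually.of_forall fun p => ?_)
      by_cases hp : p ∈ K
      · simp [hh', hp]
      · simp [hsupp p hp]
    · intro p hp
      simp [hsupp p fun h => hp (hKs h)]
  have hi2 : Integrable fun p => φ (p - (0, α)) * f' p :=
    hf'i.bdd_mul (hφ.continuous.comp (by fun_prop)).aestronglyMeasurable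
      (Filter.Eventually.of_forall fun p => hM _)
  simp_rw [hD]
  have hi1 : Integrable fun p => φ p * f' (p + (0, α)) - φ p * f' p :=
    (hφm (hf'i.comp_add_right _)).sub (hφm hf'i)
  have hi3 : Integrable fun p => ∫ t in Ioc 0 α, φ p * h' (p + (0, t)) :=
    hprod.integral_prod_right
  rw [integral_sub hi1 hi3, integral_sub (hφm (hf'i.comp_add_right _)) (hφm hf'i), htr, hlast,
    ← hw2]
  have : ∫ p, (φ p - φ (p - (0, α))) * f' p = (∫ p, φ p * f' p) - ∫ p, φ (p - (0, α)) * f' p := by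
    rw [← integral_sub (hφm hf'i) hi2]
    simp_rw [sub_mul]
  linarith

/-! ### Calculus of weak angular derivatives -/

/-- The product of a locally integrable function on the strip with a continuous function compactly
supported there is integrable. -/
theorem MeasureTheory.LocallyIntegrableOn.integrableOn_smul_strip {E : Type*}
    [NormedAddCommGroup E] [NormedSpace ℝ E] {U : ℝ × ℝ → E} (hU : LocallyIntegrableOn U strip)
    {g : ℝ × ℝ → ℝ} (hg : Continuous g) {K : Set (ℝ × ℝ)} (hK : IsCompact K) (hKs : K ⊆ strip)
    (hgK : ∀ p, p ∉ K → g p = 0) : IntegrableOn (fun p => g p • U p) strip := by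
  have h1 : IntegrableOn (fun p => g p • U p) K :=
    (hU.integrableOn_compact_subset hKs hK).continuousOn_smul hg.continuousOn hK
  have h2 : Integrable (fun p => g p • U p) :=
    (integrableOn_iff_integrable_of_support_subset
      (Function.support_subset_iff'.2 fun p hp => by simp [hgK p hp])).1 h1
  exact h2.integrableOn

theorem fderiv_eq_zero_of_notMem_tsupport {φ : ℝ × ℝ → ℝ} {p : ℝ × ℝ} (hp : p ∉ tsupport φ)
    (v : ℝ × ℝ) : fderiv ℝ φ p v = 0 := by
  have h : p ∉ Function.support (fderiv ℝ φ) := fun h => hp (support_fderiv_subset ℝ h)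
  rw [Function.notMem_support.1 h]
  rfl

theorem ContDiff.continuous_fderiv_const {φ : ℝ × ℝ → ℝ} (hφ : ContDiff ℝ ∞ φ) (v : ℝ × ℝ) :
    Continuous fun p => fderiv ℝ φ p v :=
  (hφ.continuous_fderiv (by simp)).clm_apply continuous_const

theorem notMem_tsupport_eq_zero {φ : ℝ × ℝ → ℝ} {p : ℝ × ℝ} (hp : p ∉ tsupport φ) : φ p = 0 :=
  image_eq_zero_of_notMem_tsupport hp

theorem MeasureTheory.LocallyIntegrableOn.integrableOn_mul_strip {f : ℝ × ℝ → ℝ}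
    (hf : LocallyIntegrableOn f strip) {g : ℝ × ℝ → ℝ} (hg : Continuous g) {K : Set (ℝ × ℝ)}
    (hK : IsCompact K) (hKs : K ⊆ strip) (hgK : ∀ p, p ∉ K → g p = 0) :
    IntegrableOn (fun p => g p * f p) strip :=
  hf.integrableOn_smul_strip hg hK hKs hgK

namespace IsWeakAngularDeriv

variable {f h f₁ h₁ f₂ h₂ : ℝ × ℝ → ℝ}

theorem add (H₁ : IsWeakAngularDeriv f₁ h₁) (H₂ : IsWeakAngularDeriv f₂ h₂) :
    IsWeakAngularDeriv (fun p => f₁ p + f₂ p) fun p => h₁ p + h₂ p := by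
  refine ⟨H₁.1.add H₂.1, H₁.2.1.add H₂.2.1, fun φ hφ hc hs => ?_⟩
  have hd : ∀ p, p ∉ tsupport φ → fderiv ℝ φ p (0, 1) = 0 := fun p hp =>
    fderiv_eq_zero_of_notMem_tsupport hp _
  simp_rw [mul_add]
  rw [integral_add (H₁.1.integrableOn_mul_strip (hφ.continuous_fderiv_const _) hc hs hd)
      (H₂.1.integrableOn_mul_strip (hφ.continuous_fderiv_const _) hc hs hd),
    integral_add (H₁.2.1.integrableOn_mul_strip hφ.continuous hc hs
        fun _ => notMem_tsupport_eq_zero)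
      (H₂.2.1.integrableOn_mul_strip hφ.continuous hc hs fun _ => notMem_tsupport_eq_zero),
    H₁.2.2 φ hφ hc hs, H₂.2.2 φ hφ hc hs]
  ring

/-- The factor is absorbed into the test function: `φ c` is again admissible, and the product rule
for it yields the extra term. -/
theorem mul_angle (H : IsWeakAngularDeriv f h) {c c' : ℝ → ℝ} (hc : ContDiff ℝ ∞ c)
    (hc' : ∀ θ, HasDerivAt c (c' θ) θ) :
    IsWeakAngularDeriv (fun p => c p.2 * f p) fun p => c p.2 * h p + c' p.2 * f p := by
  have hcc : Continuous fun p : ℝ × ℝ => c p.2 := hc.continuous.comp continuous_snd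
  have hcc' : Continuous c' := by
    have : c' = deriv c := funext fun θ => (hc' θ).deriv.symm
    rw [this]
    exact hc.continuous_deriv (by simp)
  have hcc'' : Continuous fun p : ℝ × ℝ => c' p.2 := hcc'.comp continuous_snd
  have hlc := isOpen_strip.isLocallyClosed
  refine ⟨H.1.continuousOn_mul hcc.continuousOn hlc,
    (H.2.1.continuousOn_mul hcc.continuousOn hlc).add
      (H.1.continuousOn_mul hcc''.continuousOn hlc), fun φ hφ hφc hs => ?_⟩
  have hts : tsupport (fun p : ℝ × ℝ => φ p * c p.2) ⊆ tsupport φ :=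
    tsupport_mul_subset_left
  have hprod : ContDiff ℝ ∞ fun p : ℝ × ℝ => φ p * c p.2 := hφ.mul (hc.comp contDiff_snd)
  have hw := H.2.2 _ hprod (hφc.mul_right) (hts.trans hs)
  have hfd : ∀ p : ℝ × ℝ, fderiv ℝ (fun p : ℝ × ℝ => φ p * c p.2) p (0, 1) =
      fderiv ℝ φ p (0, 1) * c p.2 + φ p * c' p.2 := fun p => by
    have h1 : HasFDerivAt φ (fderiv ℝ φ p) p := (hφ.differentiable (by simp) p).hasFDerivAt
    have h2 : HasFDerivAt (fun p : ℝ × ℝ => c p.2) _ p :=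
      (hc' p.2).hasFDerivAt.comp p hasFDerivAt_snd
    have h3 : HasFDerivAt (fun p : ℝ × ℝ => φ p * c p.2) _ p := h1.mul h2
    rw [h3.fderiv]
    simp
    ring
  simp_rw [hfd] at hw
  have hd : ∀ p, p ∉ tsupport φ → fderiv ℝ φ p (0, 1) = 0 := fun p hp =>
    fderiv_eq_zero_of_notMem_tsupport hp _
  have i1 : IntegrableOn (fun p => fderiv ℝ φ p (0, 1) * (c p.2 * f p)) strip := by
    have := H.1.integrableOn_mul_strip (g := fun p => fderiv ℝ φ p (0, 1) * c p.2)
      ((hφ.continuous_fderiv_const (0, 1)).mul hcc) hφc hs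
      fun p hp => by simp [hd p hp]
    simpa only [mul_assoc] using this
  have i2 : IntegrableOn (fun p => φ p * (c' p.2 * f p)) strip := by
    have := H.1.integrableOn_mul_strip (g := fun p => φ p * c' p.2)
      (hφ.continuous.mul hcc'') hφc hs
      fun p hp => by simp [notMem_tsupport_eq_zero hp]
    simpa only [mul_assoc] using this
  have i3 : IntegrableOn (fun p => φ p * (c p.2 * h p)) strip := by
    have := H.2.1.integrableOn_mul_strip (g := fun p => φ p * c p.2)
      (hφ.continuous.mul hcc) hφc hs
      fun p hp => by simp [notMem_tsupport_eq_zero hp]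
    simpa only [mul_assoc] using this
  simp only [add_mul, mul_assoc, mul_add] at hw ⊢
  rw [integral_add i1 i2] at hw
  rw [integral_add i3 i2]
  linarith

theorem congr_deriv (H : IsWeakAngularDeriv f h) (hh : ∀ᵐ p : ℝ × ℝ, p ∈ strip → h p = h₁ p) :
    IsWeakAngularDeriv f h₁ := by
  have hr : h =ᵐ[volume.restrict strip] h₁ :=
    (ae_restrict_iff' isOpen_strip.measurableSet).2 hh
  refine ⟨H.1, H.2.1.congr hr, fun φ hφ hc hs => ?_⟩
  have h1 : ∫ p in strip, φ p * h p = ∫ p in strip, φ p * h₁ p :=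
    integral_congr_ae ((Filter.EventuallyEq.refl _ φ).mul hr)
  rw [H.2.2 φ hφ hc hs, h1]

theorem ae_unique (H₁ : IsWeakAngularDeriv f h₁) (H₂ : IsWeakAngularDeriv f h₂) :
    ∀ᵐ p : ℝ × ℝ, p ∈ strip → h₁ p = h₂ p := by
  suffices H : ∀ᵐ p : ℝ × ℝ, p ∈ strip → h₁ p - h₂ p = 0 by
    filter_upwards [H] with p hp hps using sub_eq_zero.1 (hp hps)
  refine isOpen_strip.ae_eq_zero_of_integral_contDiff_smul_eq_zero (H₁.2.1.sub H₂.2.1)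
    fun φ hφ hc hs => ?_
  rw [← setIntegral_eq_integral_of_forall_compl_eq_zero (s := strip)
    fun p hp => by simp [notMem_tsupport_eq_zero fun h => hp (hs h)]]
  simp_rw [smul_eq_mul, mul_sub]
  rw [integral_sub (H₁.2.1.integrableOn_mul_strip hφ.continuous hc hs
        fun _ => notMem_tsupport_eq_zero)
      (H₂.2.1.integrableOn_mul_strip hφ.continuous hc hs fun _ => notMem_tsupport_eq_zero)]
  linarith [H₁.2.2 φ hφ hc hs, H₂.2.2 φ hφ hc hs]

theorem translate (H : IsWeakAngularDeriv f h) (a : ℝ) :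
    IsWeakAngularDeriv (fun p => f (p + (0, a))) fun p => h (p + (0, a)) := by
  refine ⟨H.1.comp_add_angle a, H.2.1.comp_add_angle a, fun φ hφ hc hs => ?_⟩
  have hmp : MeasurePreserving (fun p : ℝ × ℝ => p + (0, a)) := measurePreserving_add_right _ _
  have hpre : (fun p : ℝ × ℝ => p + (0, a)) ⁻¹' strip = strip := by
    ext p
    simp [strip]
  have htr : ∀ g : ℝ × ℝ → ℝ, ∫ p in strip, g (p + (0, a)) = ∫ p in strip, g p := fun g => by
    conv_lhs => rw [← hpre]
    exact hmp.setIntegral_preimage_emb (measurableEmbedding_addRight _) g strip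
  have hψ : ContDiff ℝ ∞ fun p : ℝ × ℝ => φ (p - (0, a)) := hφ.comp (contDiff_id.sub contDiff_const)
  have hKc : IsCompact ((fun p : ℝ × ℝ => p + (0, a)) '' tsupport φ) :=
    hc.isCompact.image (by fun_prop)
  have hKs : (fun p : ℝ × ℝ => p + (0, a)) '' tsupport φ ⊆ strip := by
    rintro _ ⟨p, hp, rfl⟩
    exact add_angle_mem_strip (hs hp) a
  have h0 : ∀ p, p ∉ (fun p : ℝ × ℝ => p + (0, a)) '' tsupport φ → φ (p - (0, a)) = 0 :=
    fun p hp => notMem_tsupport_eq_zero fun h => hp ⟨p - (0, a), h, by simp⟩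
  have hw := H.2.2 _ hψ (HasCompactSupport.intro hKc h0)
    ((closure_minimal (Function.support_subset_iff'.2 h0) hKc.isClosed).trans hKs)
  simp_rw [fderiv_comp_sub] at hw
  rw [← htr, ← htr fun p => φ (p - (0, a)) * h p] at hw
  simpa only [add_sub_cancel_right] using hw

/-- The weak angular derivative of a periodic function is periodic. -/
theorem ae_periodic (H : IsWeakAngularDeriv f h) {a : ℝ} (hf : ∀ p, f (p + (0, a)) = f p) :
    ∀ᵐ p : ℝ × ℝ, p ∈ strip → h (p + (0, a)) = h p := by
  have h1 := H.translate a
  simp_rw [hf] at h1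
  exact h1.ae_unique H

end IsWeakAngularDeriv

theorem IsWeakDeriv.isWeakAngularDeriv {U V : ℝ × ℝ → E3} (H : IsWeakDeriv (0, 1) U V)
    (i : Fin 3) : IsWeakAngularDeriv (fun p => U p i) fun p => V p i := by
  set L : E3 →L[ℝ] ℝ := EuclideanSpace.proj i
  have hloc : ∀ {W : ℝ × ℝ → E3}, LocallyIntegrableOn W strip →
      LocallyIntegrableOn (fun p => W p i) strip := fun hW p hp => by
    obtain ⟨s, hs, hi⟩ := hW p hp
    exact ⟨s, hs, L.integrable_comp hi⟩
  refine ⟨hloc H.1, hloc H.2.1, fun φ hφ hc hs => ?_⟩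
  have hw := congrArg L (H.2.2 φ hφ hc hs)
  rw [map_neg, ← L.integral_comp_comm (H.1.integrableOn_smul_strip (hφ.continuous_fderiv_const _)
      hc hs fun p hp => fderiv_eq_zero_of_notMem_tsupport hp _),
    ← L.integral_comp_comm (H.2.1.integrableOn_smul_strip hφ.continuous hc hs
      fun _ => notMem_tsupport_eq_zero)] at hw
  simpa [L] using hw

theorem inner_E3 (x y : E3) : inner ℝ x y = x 0 * y 0 + x 1 * y 1 + x 2 * y 2 := by
  simp [PiLp.inner_apply, Fin.sum_univ_three, mul_comm]

theorem IsWeakDeriv.inner_angle {U V : ℝ × ℝ → E3} (H : IsWeakDeriv (0, 1) U V)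
    {X X' : ℝ → E3} (hX : ∀ i, ContDiff ℝ ∞ fun θ => X θ i)
    (hX' : ∀ i θ, HasDerivAt (fun θ => X θ i) (X' θ i) θ) :
    IsWeakAngularDeriv (fun p => inner ℝ (X p.2) (U p))
      fun p => inner ℝ (X p.2) (V p) + inner ℝ (X' p.2) (U p) := by
  have h := fun i => (H.isWeakAngularDeriv i).mul_angle (hX i) (hX' i)
  convert ((h 0).add (h 1)).add (h 2) using 2 with p p
  · exact inner_E3 _ _
  · simp only [inner_E3]
    ring

/-! ### The tangent frame, parallel fields and holonomy -/

/-- The unit vector `∂_r` on the generator with angle `θ`. -/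
def generatorField (α θ : ℝ) : E3 :=
  !₂[α / (2 * Real.pi) * Real.cos (2 * Real.pi * θ / α),
     α / (2 * Real.pi) * Real.sin (2 * Real.pi * θ / α), √(1 - (α / (2 * Real.pi)) ^ 2)]

/-- The unit vector `r⁻¹ ∂_θ` on the generator with angle `θ`. -/
def latitudeField (α θ : ℝ) : E3 :=
  !₂[-Real.sin (2 * Real.pi * θ / α), Real.cos (2 * Real.pi * θ / α), 0]

/-- The angular derivative of `latitudeField`. -/
def latitudeFieldDeriv (α θ : ℝ) : E3 :=
  !₂[-(2 * Real.pi / α) * Real.cos (2 * Real.pi * θ / α),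
     -(2 * Real.pi / α) * Real.sin (2 * Real.pi * θ / α), 0]

/-- The tangent field that is parallel along the circles of latitude and makes the angle `φ` with
the generator `θ = 0`. -/
def parallelField (α φ θ : ℝ) : E3 :=
  Real.cos (θ + φ) • generatorField α θ - Real.sin (θ + φ) • latitudeField α θ

section Geometry

variable {α : ℝ}

theorem cone_sin_sq_le_one (hα0 : 0 < α) (hα1 : α < 2 * Real.pi) :
    (α / (2 * Real.pi)) ^ 2 ≤ 1 := by
  have h1 : α / (2 * Real.pi) ≤ 1 := (div_le_one (by positivity)).2 hα1.le
  have h0 : 0 ≤ α / (2 * Real.pi) := by positivity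
  exact pow_le_one₀ h0 h1

theorem conePoint_eq_smul (r θ : ℝ) : conePoint α (r, θ) = r • generatorField α θ := by
  ext i
  fin_cases i <;> simp [conePoint, generatorField]

theorem inner_generator_generator (hα0 : 0 < α) (hα1 : α < 2 * Real.pi) (θ : ℝ) :
    inner ℝ (generatorField α θ) (generatorField α θ) = 1 := by
  have h := Real.sq_sqrt (sub_nonneg.2 (cone_sin_sq_le_one hα0 hα1))
  have h2 := Real.sin_sq_add_cos_sq (2 * Real.pi * θ / α)
  simp only [inner_E3, generatorField, Matrix.cons_val]
  linear_combination (α / (2 * Real.pi)) ^ 2 * h2 + h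

theorem inner_latitude_latitude (θ : ℝ) :
    inner ℝ (latitudeField α θ) (latitudeField α θ) = 1 := by
  have h2 := Real.sin_sq_add_cos_sq (2 * Real.pi * θ / α)
  simp only [inner_E3, latitudeField, Matrix.cons_val]
  linear_combination h2

theorem inner_generator_latitude (θ : ℝ) :
    inner ℝ (generatorField α θ) (latitudeField α θ) = 0 := by
  simp only [inner_E3, latitudeField, generatorField, Matrix.cons_val]
  ring

theorem norm_generatorField (hα0 : 0 < α) (hα1 : α < 2 * Real.pi) (θ : ℝ) :
    ‖generatorField α θ‖ = 1 := by
  rw [norm_eq_sqrt_real_inner, inner_generator_generator hα0 hα1, Real.sqrt_one]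

theorem norm_latitudeField (θ : ℝ) : ‖latitudeField α θ‖ = 1 := by
  rw [norm_eq_sqrt_real_inner, inner_latitude_latitude, Real.sqrt_one]

theorem norm_conePoint (hα0 : 0 < α) (hα1 : α < 2 * Real.pi) {r : ℝ} (hr : 0 < r) (θ : ℝ) :
    ‖conePoint α (r, θ)‖ = r := by
  rw [conePoint_eq_smul, norm_smul, norm_generatorField hα0 hα1, mul_one, Real.norm_of_nonneg hr.le]

theorem coneN_conePoint (hα0 : 0 < α) (hα1 : α < 2 * Real.pi) {r : ℝ} (hr : 0 < r) (θ : ℝ) :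
    coneN (conePoint α (r, θ)) = generatorField α θ := by
  rw [coneN, norm_conePoint hα0 hα1 hr, conePoint_eq_smul, smul_smul, inv_mul_cancel₀ hr.ne',
    one_smul]

theorem coneT_conePoint (hα0 : 0 < α) {r : ℝ} (hr : 0 < r) (θ : ℝ) :
    coneT (conePoint α (r, θ)) = latitudeField α θ := by
  have hpos : 0 < r * (α / (2 * Real.pi)) := by positivity
  have hs : √(conePoint α (r, θ) 0 ^ 2 + conePoint α (r, θ) 1 ^ 2) = r * (α / (2 * Real.pi)) := by
    rw [Real.sqrt_eq_iff_mul_self_eq_of_pos hpos]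
    have h2 := Real.sin_sq_add_cos_sq (2 * Real.pi * θ / α)
    simp only [conePoint, PiLp.toLp_apply, Matrix.cons_val]
    linear_combination -(r * (α / (2 * Real.pi))) ^ 2 * h2
  have hmul : ∀ c : ℝ, (r * (α / (2 * Real.pi)))⁻¹ * (r * (α / (2 * Real.pi) * c)) = c := fun c => by
    rw [← mul_assoc r, inv_mul_cancel_left₀ hpos.ne']
  rw [coneT, hs]
  ext i
  fin_cases i
  · simpa [conePoint, latitudeField] using hmul _
  · simpa [conePoint, latitudeField] using hmul _
  · simp [latitudeField]

theorem coneTangentSpace_conePoint (hα0 : 0 < α) (hα1 : α < 2 * Real.pi) {p : ℝ × ℝ}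
    (hp : 0 < p.1) : coneTangentSpace (conePoint α p) =
      Submodule.span ℝ {generatorField α p.2, latitudeField α p.2} := by
  rw [coneTangentSpace, coneN_conePoint hα0 hα1 hp, coneT_conePoint hα0 hp]

theorem angle_add_period (hα : α ≠ 0) (θ : ℝ) :
    2 * Real.pi * (θ + α) / α = 2 * Real.pi * θ / α + 2 * Real.pi := by
  field_simp

theorem generatorField_add_period (hα : α ≠ 0) (θ : ℝ) :
    generatorField α (θ + α) = generatorField α θ := by
  simp [generatorField, angle_add_period hα]

theorem latitudeField_add_period (hα : α ≠ 0) (θ : ℝ) :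
    latitudeField α (θ + α) = latitudeField α θ := by
  simp [latitudeField, angle_add_period hα]

theorem conePoint_add_period (hα : α ≠ 0) (p : ℝ × ℝ) :
    conePoint α (p + (0, α)) = conePoint α p := by
  obtain ⟨r, θ⟩ := p
  simp [conePoint_eq_smul, generatorField_add_period hα]

theorem contDiff_generatorField (i : Fin 3) : ContDiff ℝ ∞ fun θ => generatorField α θ i := by
  fin_cases i <;> simp only [generatorField, PiLp.toLp_apply, Fin.zero_eta, Fin.mk_one,
    Fin.reduceFinMk, Matrix.cons_val] <;> fun_prop

theorem contDiff_latitudeField (i : Fin 3) : ContDiff ℝ ∞ fun θ => latitudeField α θ i := by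
  fin_cases i <;> simp only [latitudeField, PiLp.toLp_apply, Fin.zero_eta, Fin.mk_one,
    Fin.reduceFinMk, Matrix.cons_val] <;> fun_prop

theorem hasDerivAt_generatorField (hα : α ≠ 0) (i : Fin 3) (θ : ℝ) :
    HasDerivAt (fun θ => generatorField α θ i) (latitudeField α θ i) θ := by
  have h0 : HasDerivAt (fun θ => 2 * Real.pi * θ / α) (2 * Real.pi / α) θ := by
    simpa using ((hasDerivAt_id θ).const_mul (2 * Real.pi)).div_const α
  have hp := Real.pi_ne_zero
  fin_cases i <;> simp only [generatorField, latitudeField, PiLp.toLp_apply, Fin.zero_eta,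
    Fin.mk_one, Fin.reduceFinMk, Matrix.cons_val]
  · refine (h0.cos.const_mul (α / (2 * Real.pi))).congr_deriv ?_
    field_simp
  · refine (h0.sin.const_mul (α / (2 * Real.pi))).congr_deriv ?_
    field_simp
  · exact hasDerivAt_const _ _

theorem hasDerivAt_latitudeField (i : Fin 3) (θ : ℝ) :
    HasDerivAt (fun θ => latitudeField α θ i) (latitudeFieldDeriv α θ i) θ := by
  have h0 : HasDerivAt (fun θ => 2 * Real.pi * θ / α) (2 * Real.pi / α) θ := by
    simpa using ((hasDerivAt_id θ).const_mul (2 * Real.pi)).div_const α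
  fin_cases i <;> simp only [latitudeFieldDeriv, latitudeField, PiLp.toLp_apply, Fin.zero_eta,
    Fin.mk_one, Fin.reduceFinMk, Matrix.cons_val]
  · exact h0.sin.neg.congr_deriv (by ring)
  · exact h0.cos.congr_deriv (by ring)
  · exact hasDerivAt_const _ _

theorem contDiff_parallelField (φ : ℝ) (i : Fin 3) :
    ContDiff ℝ ∞ fun θ => parallelField α φ θ i := by
  have h1 := contDiff_generatorField (α := α) i
  have h2 := contDiff_latitudeField (α := α) i
  simp only [parallelField, PiLp.sub_apply, PiLp.smul_apply, smul_eq_mul]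
  fun_prop

/-- Since the generator field has derivative the latitude field, the two cosine terms cancel. What
remains is normal to the cone, which is why the field is parallel. -/
theorem hasDerivAt_parallelField (hα : α ≠ 0) (φ : ℝ) (i : Fin 3) (θ : ℝ) :
    HasDerivAt (fun θ => parallelField α φ θ i)
      ((-Real.sin (θ + φ) • (generatorField α θ + latitudeFieldDeriv α θ)) i) θ := by
  have h0 : HasDerivAt (fun θ => θ + φ) 1 θ := (hasDerivAt_id θ).add_const φ
  simp only [parallelField, PiLp.sub_apply, PiLp.smul_apply, PiLp.add_apply, smul_eq_mul]
  exact ((h0.cos.mul (hasDerivAt_generatorField hα i θ)).sub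
    (h0.sin.mul (hasDerivAt_latitudeField i θ))).congr_deriv (by ring)

/-- The covariant angular derivative of `latitudeField` is `-generatorField`. -/
theorem inner_generator_add_latitudeDeriv (hα0 : 0 < α) (hα1 : α < 2 * Real.pi) {θ : ℝ} {v : E3}
    (hv : v ∈ Submodule.span ℝ {generatorField α θ, latitudeField α θ}) :
    inner ℝ (generatorField α θ + latitudeFieldDeriv α θ) v = 0 := by
  obtain ⟨a, b, rfl⟩ := Submodule.mem_span_pair.1 hv
  have hσ : α / (2 * Real.pi) * (2 * Real.pi / α) = 1 := by
    have := Real.pi_ne_zero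
    field_simp
  have h1 : inner ℝ (latitudeFieldDeriv α θ) (generatorField α θ) = -1 := by
    have h2 := Real.sin_sq_add_cos_sq (2 * Real.pi * θ / α)
    simp only [inner_E3, latitudeFieldDeriv, generatorField, Matrix.cons_val]
    linear_combination -(α / (2 * Real.pi) * (2 * Real.pi / α)) * h2 - hσ
  have h2 : inner ℝ (latitudeFieldDeriv α θ) (latitudeField α θ) = 0 := by
    simp only [inner_E3, latitudeFieldDeriv, latitudeField, Matrix.cons_val]
    ring
  simp only [inner_add_left, inner_add_right, inner_smul_right, h1, h2,
    inner_generator_generator hα0 hα1, inner_generator_latitude]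
  ring

/-- The rotation picked up on the way round the tip moves every tangent vector by a definite
proportion of its length. -/
theorem holonomy_le (hα0 : 0 < α) (hα1 : α < 2 * Real.pi) {θ : ℝ} {v : E3}
    (hv : v ∈ Submodule.span ℝ {generatorField α θ, latitudeField α θ}) :
    √(2 - 2 * Real.cos α) * ‖v‖ ≤
      |inner ℝ (parallelField α 0 (θ + α)) v - inner ℝ (parallelField α 0 θ) v| +
      |inner ℝ (parallelField α (-(Real.pi / 2)) (θ + α)) v -
        inner ℝ (parallelField α (-(Real.pi / 2)) θ) v| := by
  obtain ⟨a, b, rfl⟩ := Submodule.mem_span_pair.1 hv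
  have hTN : inner ℝ (latitudeField α θ) (generatorField α θ) = 0 := by
    rw [real_inner_comm, inner_generator_latitude]
  have hn : ‖a • generatorField α θ + b • latitudeField α θ‖ ^ 2 = a ^ 2 + b ^ 2 := by
    rw [← real_inner_self_eq_norm_sq]
    simp only [inner_add_left, inner_add_right, inner_smul_right, inner_smul_left, hTN,
      inner_generator_generator hα0 hα1, inner_generator_latitude, inner_latitude_latitude]
    simp
    ring
  have hc : 0 ≤ 2 - 2 * Real.cos α := by linarith [Real.cos_le_one α]
  have e : ∀ φ : ℝ, inner ℝ (Real.cos φ • generatorField α θ - Real.sin φ • latitudeField α θ)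
      (a • generatorField α θ + b • latitudeField α θ) = a * Real.cos φ - b * Real.sin φ := by
    intro φ
    simp only [inner_sub_left, inner_add_right, inner_smul_right, inner_smul_left, hTN,
      inner_generator_generator hα0 hα1, inner_generator_latitude, inner_latitude_latitude]
    simp
    ring
  simp only [parallelField, generatorField_add_period hα0.ne', latitudeField_add_period hα0.ne',
    add_zero, e]
  -- The phases `0` and `-π/2` give two orthonormal parallel fields, so the two differences are the
  -- components of the displacement of `v`.
  simp only [← sub_eq_add_neg, Real.cos_sub_pi_div_two, Real.sin_sub_pi_div_two]
  refine (pow_le_pow_iff_left₀ (by positivity) (by positivity) two_ne_zero).1 ?_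
  have h1 := Real.sin_sq_add_cos_sq θ
  have h2 := Real.sin_sq_add_cos_sq (θ + α)
  have h3 : Real.cos α = Real.cos (θ + α) * Real.cos θ + Real.sin (θ + α) * Real.sin θ := by
    rw [← Real.cos_sub, add_sub_cancel_left]
  rw [mul_pow, Real.sq_sqrt hc, hn, add_sq, sq_abs, sq_abs]
  -- The two squares alone sum to the left side exactly; the cross term `2 |x| |y|` is discarded.
  refine le_trans (le_of_eq ?_) (add_le_add_left (le_add_of_nonneg_right (by positivity)) _)
  rw [h3]
  linear_combination -(a ^ 2 + b ^ 2) * (h1 + h2)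

/-! ### Polar coordinates and geodesic balls at the tip -/

theorem continuous_generatorField : Continuous (generatorField α) :=
  (PiLp.continuous_toLp 2 _).comp (continuous_pi fun i => (contDiff_generatorField i).continuous)

theorem continuous_latitudeField : Continuous (latitudeField α) :=
  (PiLp.continuous_toLp 2 _).comp (continuous_pi fun i => (contDiff_latitudeField i).continuous)

theorem continuous_conePoint : Continuous (conePoint α) := by
  have : conePoint α = fun p => p.1 • generatorField α p.2 := funext fun p => conePoint_eq_smul _ _
  rw [this]
  exact continuous_fst.smul (continuous_generatorField.comp continuous_snd)

theorem conePoint_mem_cone (hα0 : 0 < α) (hα1 : α < 2 * Real.pi) {r : ℝ} (hr0 : 0 < r)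
    (hr1 : r ≤ 1) (θ : ℝ) : conePoint α (r, θ) ∈ cone α := by
  refine ⟨?_, ?_, ?_⟩
  · rwa [norm_conePoint hα0 hα1 hr0]
  · rwa [norm_conePoint hα0 hα1 hr0]
  · rw [norm_conePoint hα0 hα1 hr0]
    simp [conePoint, mul_comm]

/-- The segment of the generator down to the tip is an admissible curve with Lipschitz constant `r`.
Only this bound is needed: it puts all small circles inside the geodesic ball. -/
theorem coneDist_conePoint_zero_le (hα0 : 0 < α) (hα1 : α < 2 * Real.pi) {r : ℝ} (hr0 : 0 < r)
    (hr1 : r ≤ 1) (θ : ℝ) : coneDist α (conePoint α (r, θ)) 0 ≤ ENNReal.ofReal r := by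
  set x := conePoint α (r, θ) with hx
  have hxn : ‖x‖ = r := norm_conePoint hα0 hα1 hr0 θ
  set c : ℝ → E3 := fun t => (1 - t) • x with hc
  have hL : LipschitzWith (Real.toNNReal r) c := LipschitzWith.of_dist_le_mul fun s t => by
    rw [dist_eq_norm, hc]
    simp only [← sub_smul, norm_smul, hxn, Real.coe_toNNReal r hr0.le, Real.dist_eq,
      Real.norm_eq_abs]
    rw [mul_comm, abs_sub_comm s t]
    ring_nf
    exact le_rfl
  have hmem : ∀ t ∈ Icc (0 : ℝ) 1, c t ∈ insert 0 (cone α) := fun t ht => by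
    rcases ht.2.eq_or_lt with rfl | h1
    · simp [hc]
    · right
      have : c t = conePoint α ((1 - t) * r, θ) := by
        simp [hc, hx, conePoint_eq_smul, smul_smul]
      rw [this]
      exact conePoint_mem_cone hα0 hα1 (mul_pos (by linarith) hr0)
        (by nlinarith [ht.1]) θ
  refine (iInf₂_le_of_le c hL.continuous.continuousOn (iInf₂_le_of_le (by simp [hc])
    (by simp [hc]) (iInf_le_of_le hmem ?_)))
  have := (hL.lipschitzOnWith (s := univ)).comp_eVariationOn_le (g := id) (s := Icc (0 : ℝ) 1)
    (mapsTo_univ _ _)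
  simpa [ENNReal.ofReal] using this

theorem conePoint_mem_coneBall (hα0 : 0 < α) (hα1 : α < 2 * Real.pi) {r ρ : ℝ} (hr0 : 0 < r)
    (hr1 : r ≤ 1) (hρ : r < ρ) (θ : ℝ) : conePoint α (r, θ) ∈ coneBall α 0 ρ :=
  ⟨conePoint_mem_cone hα0 hα1 hr0 hr1 θ, (coneDist_conePoint_zero_le hα0 hα1 hr0 hr1 θ).trans_lt
    ((ENNReal.ofReal_lt_ofReal_iff (hr0.trans hρ)).2 hρ)⟩

end Geometry

/-! ### Almost everywhere on the cone, on a period, on the strip -/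

/-- A property that holds almost everywhere on the cone holds almost everywhere in polar
coordinates. -/
theorem ae_polar_of_ae_coneMeasure {α : ℝ} {P : E3 → Prop} (h : ∀ᵐ x ∂coneMeasure α, P x) :
    ∀ᵐ p : ℝ × ℝ, p ∈ Ioo (0 : ℝ) 1 ×ˢ Ioo (0 : ℝ) α → P (conePoint α p) := by
  have h1 := ae_of_ae_map continuous_conePoint.aemeasurable h
  rw [ae_withDensity_iff (by fun_prop),
    ae_restrict_iff' (measurableSet_Ioo.prod measurableSet_Ioo)] at h1
  filter_upwards [h1] with p hp hpm
  exact hp hpm (by simpa using hpm.1.1)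

theorem ae_snd_ne (c : ℝ) : ∀ᵐ p : ℝ × ℝ, p.2 ≠ c :=
  (Measure.quasiMeasurePreserving_snd (μ := (volume : Measure ℝ)) (ν := (volume : Measure ℝ))).ae
    (Measure.ae_ne volume c)

/-- A periodic property that holds almost everywhere on a period holds almost everywhere on the
strip. -/
theorem ae_strip_of_periodic {α : ℝ} (hα : 0 < α) {P : ℝ × ℝ → Prop}
    (hP : ∀ p, P (p + (0, α)) ↔ P p)
    (h : ∀ᵐ p : ℝ × ℝ, p ∈ Ioo (0 : ℝ) 1 ×ˢ Ioo (0 : ℝ) α → P p) :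
    ∀ᵐ p : ℝ × ℝ, p ∈ strip → P p := by
  have hPz : ∀ (n : ℤ) p, P (p + (0, n * α)) ↔ P p := by
    intro n
    induction n using Int.induction_on with
    | zero => simp
    | succ n ih =>
      intro p
      rw [← ih p, ← hP (p + (0, ((n : ℤ) : ℝ) * α)), add_assoc]
      simp [add_mul]
    | pred n ih =>
      intro p
      rw [← ih p, ← hP, add_assoc]
      simp [sub_mul]
  have h1 : ∀ᵐ p : ℝ × ℝ, ∀ n : ℤ,
      p + (0, n * α) ∈ Ioo (0 : ℝ) 1 ×ˢ Ioo (0 : ℝ) α → P (p + (0, n * α)) :=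
    ae_all_iff.2 fun n =>
      (measurePreserving_add_right volume ((0 : ℝ), n * α)).quasiMeasurePreserving.ae h
  -- The translates of the open period miss the lines `θ = nα`, a null set that has to be removed.
  have h2 : ∀ᵐ p : ℝ × ℝ, ∀ n : ℤ, p.2 ≠ n * α := ae_all_iff.2 fun n => ae_snd_ne _
  filter_upwards [h1, h2] with p hp hne hps
  obtain ⟨n, hn, -⟩ := existsUnique_add_zsmul_mem_Ico hα p.2 0
  rw [zsmul_eq_mul] at hn
  refine (hPz n p).1 (hp n ⟨by simpa using hps.1, lt_of_le_of_ne hn.1 fun h => hne (-n) ?_, ?_⟩)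
  · simp at h
    push_cast
    linarith
  · simpa using hn.2

/-! ### Logarithmic divergence of the energy -/

theorem lintegral_ofReal_inv_Ioo {r₀ : ℝ} (hr : 0 < r₀) :
    ∫⁻ r in Ioo (0 : ℝ) r₀, (ENNReal.ofReal r)⁻¹ = ⊤ := by
  by_contra hne
  have h1 : ¬ IntervalIntegrable (fun x : ℝ => x⁻¹) volume 0 r₀ := by
    rw [intervalIntegrable_inv_iff]
    simp [hr.ne, hr.le]
  refine h1 ((intervalIntegrable_iff_integrableOn_Ioo_of_le hr.le).2
    ⟨measurable_inv.aestronglyMeasurable, ?_⟩)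
  rw [hasFiniteIntegral_iff_enorm]
  refine lt_of_le_of_lt (le_of_eq ?_) (lt_top_iff_ne_top.2 hne)
  refine setLIntegral_congr_fun measurableSet_Ioo fun r hr => ?_
  have h0 : 0 < r := hr.1
  rw [Real.enorm_of_nonneg (inv_nonneg.2 h0.le), ENNReal.ofReal_inv_of_pos h0]

/-- A lower bound for the first moment gives one for the second moment. -/
theorem le_lintegral_sq {g : ℝ → ℝ≥0∞} {α c : ℝ} (hα : 0 < α) (hc : 0 < c)
    (h : ENNReal.ofReal (2 * c * α) ≤ ∫⁻ t in Ioo (0 : ℝ) α, g t) :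
    ENNReal.ofReal (c ^ 2 * α) ≤ ∫⁻ t in Ioo (0 : ℝ) α, g t ^ 2 := by
  set δ := ENNReal.ofReal c with hδ
  have hδ0 : δ ≠ 0 := by simpa [hδ] using hc
  have hδt : δ ≠ ⊤ := ENNReal.ofReal_ne_top
  -- This crude Young inequality replaces Cauchy–Schwarz and requires no measurability of `g`. The
  -- `2` in the hypothesis pays for the term `δ ^ 2`.
  have hpt : ∀ t, δ * g t ≤ δ ^ 2 + g t ^ 2 := fun t => by
    rcases le_total (g t) δ with hle | hle
    · exact (mul_le_mul_right hle δ).trans ((sq δ).symm.le.trans le_self_add)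
    · exact (mul_le_mul_left hle (g t)).trans ((sq (g t)).symm.le.trans le_add_self)
  have h1 : δ * ∫⁻ t in Ioo (0 : ℝ) α, g t ≤
      ENNReal.ofReal (c ^ 2 * α) + ∫⁻ t in Ioo (0 : ℝ) α, g t ^ 2 := by
    rw [← lintegral_const_mul' _ _ hδt]
    refine (lintegral_mono hpt).trans (le_of_eq ?_)
    rw [lintegral_add_left measurable_const]
    simp [hδ, ENNReal.ofReal_mul (sq_nonneg c), ENNReal.ofReal_pow hc.le]
  have h2 : ENNReal.ofReal (c ^ 2 * α) + ENNReal.ofReal (c ^ 2 * α) ≤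
      δ * ∫⁻ t in Ioo (0 : ℝ) α, g t := by
    refine le_trans (le_of_eq ?_) (mul_le_mul_right h δ)
    rw [hδ, ← ENNReal.ofReal_mul hc.le, ← ENNReal.ofReal_add (by positivity) (by positivity)]
    ring_nf
  exact (ENNReal.add_le_add_iff_left ENNReal.ofReal_ne_top).1 (h2.trans h1)

/-- The integral of a periodic function over an arc of length `α` that starts in the first period
is at most twice its integral over a period. -/
theorem lintegral_arc_le {g : ℝ → ℝ≥0∞} {α θ : ℝ} (hθ : θ ∈ Ioo 0 α)
    (hg : ∀ᵐ s, g (s + α) = g s) :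
    ∫⁻ t in Ioc (0 : ℝ) α, g (θ + t) ≤ 2 * ∫⁻ s in Ioo (0 : ℝ) α, g s := by
  have e1 : ∫⁻ t in Ioc (0 : ℝ) α, g (θ + t) = ∫⁻ s in Ioc θ (θ + α), g s := by
    have := (measurePreserving_add_left volume θ).setLIntegral_comp_preimage_emb
      (measurableEmbedding_addLeft θ) g (Ioc θ (θ + α))
    rw [← this, preimage_const_add_Ioc]
    simp
  have e2 : ∫⁻ s in Ioc α (2 * α), g s = ∫⁻ s in Ioc (0 : ℝ) α, g s := by
    have := (measurePreserving_add_right volume α).setLIntegral_comp_preimage_emb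
      (measurableEmbedding_addRight α) g (Ioc α (2 * α))
    rw [← this, preimage_add_const_Ioc, sub_self, two_mul, add_sub_cancel_right]
    exact setLIntegral_congr_fun_ae measurableSet_Ioc (hg.mono fun s hs _ => hs)
  have hsub : Ioc θ (θ + α) ⊆ Ioc 0 α ∪ Ioc α (2 * α) := fun s hs => by
    rcases le_or_gt s α with h | h
    · exact Or.inl ⟨hθ.1.trans hs.1, h⟩
    · exact Or.inr ⟨h, by linarith [hs.2, hθ.2]⟩
  calc ∫⁻ t in Ioc (0 : ℝ) α, g (θ + t) = ∫⁻ s in Ioc θ (θ + α), g s := e1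
    _ ≤ ∫⁻ s in Ioc 0 α ∪ Ioc α (2 * α), g s := lintegral_mono_set hsub
    _ ≤ (∫⁻ s in Ioc 0 α, g s) + ∫⁻ s in Ioc α (2 * α), g s := lintegral_union_le _ _ _
    _ = 2 * ∫⁻ s in Ioo (0 : ℝ) α, g s := by
      rw [e2, ← two_mul, setLIntegral_congr Ioo_ae_eq_Ioc]

/-- If the integrals of a periodic function along the arcs around the tip are bounded below, then
its weighted energy diverges logarithmically. -/
theorem lintegral_energy_eq_top {k : ℝ × ℝ → ℝ≥0∞} {α c r₀ : ℝ} (hα : 0 < α) (hc : 0 < c)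
    (hr₀ : 0 < r₀) (hr₁ : r₀ ≤ 1)
    (hk : AEMeasurable k (volume.restrict (Ioo (0 : ℝ) 1 ×ˢ Ioo (0 : ℝ) α)))
    (hper : ∀ᵐ p : ℝ × ℝ, p ∈ strip → k (p + (0, α)) = k p)
    (hlow : ∀ᵐ p : ℝ × ℝ, p ∈ Ioo (0 : ℝ) r₀ ×ˢ Ioo (0 : ℝ) α →
      ENNReal.ofReal c ≤ ∫⁻ t in Ioc (0 : ℝ) α, k (p + (0, t))) :
    ∫⁻ p in Ioo (0 : ℝ) 1 ×ˢ Ioo (0 : ℝ) α, (ENNReal.ofReal p.1)⁻¹ * k p ^ 2 = ⊤ := by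
  -- Chosen so that `c = 2 * (2 * m * α)`: one factor `2` is lost in passing from an arc to a
  -- period, the other in passing to second moments.
  set m := c / (4 * α) with hm
  have hm0 : 0 < m := by positivity
  have hslice : ∀ᵐ r : ℝ, r ∈ Ioo (0 : ℝ) r₀ →
      ENNReal.ofReal (m ^ 2 * α) ≤ ∫⁻ θ in Ioo (0 : ℝ) α, k (r, θ) ^ 2 := by
    filter_upwards [Measure.ae_ae_of_ae_prod hper, Measure.ae_ae_of_ae_prod hlow]
      with r h1 h2 hr
    refine le_lintegral_sq hα hm0 ?_
    have hr' : r ∈ Ioo (0 : ℝ) 1 := ⟨hr.1, hr.2.trans_le hr₁⟩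
    have hg : ∀ᵐ s : ℝ, k (r, s + α) = k (r, s) := h1.mono fun s hs => by
      simpa using hs ⟨hr', mem_univ _⟩
    have hne : (ae (volume.restrict (Ioo (0 : ℝ) α))).NeBot := by
      rw [ae_restrict_neBot]
      simpa using hα
    -- One good starting angle on each circle is enough, since its arc already covers a full period.
    obtain ⟨θ, hθ, hθ2⟩ := ((ae_restrict_mem (μ := volume) measurableSet_Ioo).and
      (ae_restrict_of_ae (s := Ioo (0 : ℝ) α) h2)).exists
    have h3 := (hθ2 ⟨hr, hθ⟩)
    simp only [Prod.mk_add_mk, add_zero] at h3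
    have h4 := h3.trans (lintegral_arc_le (g := fun s => k (r, s)) hθ hg)
    have h5 : ENNReal.ofReal c = 2 * ENNReal.ofReal (2 * m * α) := by
      rw [show (2 : ℝ≥0∞) = ENNReal.ofReal 2 by simp, ← ENNReal.ofReal_mul (by norm_num)]
      congr 1
      rw [hm]
      field_simp
      norm_num
    rw [h5] at h4
    exact (ENNReal.mul_le_mul_iff_right (by norm_num) (by norm_num)).1 h4
  have hmeas : AEMeasurable (fun p : ℝ × ℝ => (ENNReal.ofReal p.1)⁻¹ * k p ^ 2)
      ((volume.restrict (Ioo (0 : ℝ) 1)).prod (volume.restrict (Ioo (0 : ℝ) α))) := by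
    rw [Measure.prod_restrict]
    exact (by fun_prop : Measurable fun p : ℝ × ℝ => (ENNReal.ofReal p.1)⁻¹).aemeasurable.mul
      (hk.pow_const 2)
  rw [Measure.volume_eq_prod, ← Measure.prod_restrict, lintegral_prod _ hmeas, eq_top_iff]
  calc (⊤ : ℝ≥0∞) = ENNReal.ofReal (m ^ 2 * α) * ∫⁻ r in Ioo (0 : ℝ) r₀, (ENNReal.ofReal r)⁻¹ := by
        rw [lintegral_ofReal_inv_Ioo hr₀, ENNReal.mul_top]
        simpa using by positivity
    _ = ∫⁻ r in Ioo (0 : ℝ) r₀, ENNReal.ofReal (m ^ 2 * α) * (ENNReal.ofReal r)⁻¹ :=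
        (lintegral_const_mul' _ _ ENNReal.ofReal_ne_top).symm
    _ ≤ ∫⁻ r in Ioo (0 : ℝ) r₀, ∫⁻ θ in Ioo (0 : ℝ) α, (ENNReal.ofReal r)⁻¹ * k (r, θ) ^ 2 := by
        refine setLIntegral_mono_ae' measurableSet_Ioo (hslice.mono fun r h hr => ?_)
        rw [lintegral_const_mul' _ _ (ENNReal.inv_ne_top.2 (by simpa using hr.1)), mul_comm]
        exact mul_le_mul_right (h hr) _
    _ ≤ _ := lintegral_mono_set (Ioo_subset_Ioo_right hr₁)

/-! ### Frame components and the covariant derivative -/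

/-- The two components of a vector in the orthonormal tangent frame, in absolute value. -/
def frameSize (α θ : ℝ) (v : E3) : ℝ≥0∞ :=
  ‖(inner ℝ (generatorField α θ) v : ℝ)‖ₑ + ‖(inner ℝ (latitudeField α θ) v : ℝ)‖ₑ

theorem enorm_inner_parallelField_le (α φ θ : ℝ) (v : E3) :
    ‖(inner ℝ (parallelField α φ θ) v : ℝ)‖ₑ ≤ frameSize α θ v := by
  rw [parallelField, inner_sub_left, real_inner_smul_left, real_inner_smul_left]
  refine (enorm_sub_le).trans (add_le_add ?_ ?_)
  all_goals
    rw [enorm_mul]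
    refine mul_le_of_le_one_left' ?_
    rw [← ofReal_norm, Real.norm_eq_abs]
    simp [Real.abs_cos_le_one, Real.abs_sin_le_one]

/-- The frame vectors are tangent, so pairing with them sees only the tangential projection of `w`.
Each component is at most the norm of that projection, whence `2 ^ 2 = 4`; the weight is `r⁻² · r`.
-/
theorem frameSize_sq_le_covDerivNormSq {α : ℝ} (hα0 : 0 < α) (hα1 : α < 2 * Real.pi) {p : ℝ × ℝ}
    (hp : 0 < p.1) (v w : E3) :
    (ENNReal.ofReal p.1)⁻¹ * frameSize α p.2 w ^ 2 ≤
      4 * ENNReal.ofReal (covDerivNormSq α p v w * p.1) := by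
  rw [covDerivNormSq]
  set S := coneTangentSpace (conePoint α p) with hS
  have hS' := hS.trans (coneTangentSpace_conePoint hα0 hα1 hp)
  have hb : ∀ x ∈ S, ‖x‖ = 1 → ‖(inner ℝ x w : ℝ)‖ₑ ≤ ‖S.starProjection w‖ₑ := fun x hx h1 => by
    have h2 : inner ℝ x w = inner ℝ x (S.starProjection w) := by
      rw [← Submodule.inner_starProjection_left_eq_right, Submodule.starProjection_eq_self_iff.2 hx]
    rw [h2]
    refine enorm_le_iff_norm_le.2 ?_
    simpa [h1] using norm_inner_le_norm (𝕜 := ℝ) x (S.starProjection w)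
  have hsize : frameSize α p.2 w ≤ 2 * ‖S.starProjection w‖ₑ := by
    rw [two_mul]
    refine add_le_add (hb _ ?_ (norm_generatorField hα0 hα1 _)) (hb _ ?_ (norm_latitudeField _))
    · rw [hS']
      exact Submodule.subset_span (by simp)
    · rw [hS']
      exact Submodule.subset_span (by simp)
  have hreal : p.1⁻¹ * ‖S.starProjection w‖ ^ 2 ≤
      (‖S.starProjection v‖ ^ 2 + ‖p.1⁻¹ • S.starProjection w‖ ^ 2) * p.1 := by
    rw [norm_smul, Real.norm_of_nonneg (inv_nonneg.2 hp.le), add_mul]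
    refine le_add_of_nonneg_of_le (by positivity) (le_of_eq ?_)
    field_simp
  calc (ENNReal.ofReal p.1)⁻¹ * frameSize α p.2 w ^ 2
      ≤ (ENNReal.ofReal p.1)⁻¹ * (2 * ‖S.starProjection w‖ₑ) ^ 2 := by gcongr
    _ = 4 * ENNReal.ofReal (p.1⁻¹ * ‖S.starProjection w‖ ^ 2) := by
      rw [ENNReal.ofReal_mul (inv_nonneg.2 hp.le), ENNReal.ofReal_inv_of_pos hp,
        ENNReal.ofReal_pow (norm_nonneg _), ofReal_norm, mul_pow]
      ring_nf
    _ ≤ _ := by gcongr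

end

/-! ### The holonomy estimate for Sobolev fields and the conclusion -/

/-- The derivative of a parallel field is normal and `U` is tangent, so `⟪X, U⟫` has weak angular
derivative `⟪X, V⟫`. Because `U` is periodic, its change over an arc is that of `X` paired with the
fixed vector `U p`. The factor `2` counts the two parallel fields. -/
theorem ae_holonomy_le_arc {α : ℝ} (hα0 : 0 < α) (hα1 : α < 2 * Real.pi) {U V : ℝ × ℝ → E3}
    (hUV : IsWeakDeriv (0, 1) U V) (hper : ∀ p, U (p + (0, α)) = U p)
    (htan : ∀ᵐ p : ℝ × ℝ, p ∈ strip →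
      U p ∈ Submodule.span ℝ {generatorField α p.2, latitudeField α p.2}) :
    ∀ᵐ p : ℝ × ℝ, p ∈ strip → ENNReal.ofReal (√(2 - 2 * Real.cos α) * ‖U p‖) ≤
      2 * ∫⁻ t in Ioc (0 : ℝ) α, frameSize α (p.2 + t) (V (p + (0, t))) := by
  have hw : ∀ φ, IsWeakAngularDeriv (fun p => inner ℝ (parallelField α φ p.2) (U p))
      fun p => inner ℝ (parallelField α φ p.2) (V p) := fun φ => by
    refine (hUV.inner_angle (contDiff_parallelField φ)
      (hasDerivAt_parallelField hα0.ne' φ)).congr_deriv ?_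
    filter_upwards [htan] with p hp hps
    rw [real_inner_smul_left, inner_generator_add_latitudeDeriv hα0 hα1 (hp hps), mul_zero,
      add_zero]
  have hle : ∀ φ, ∀ᵐ p : ℝ × ℝ, p ∈ strip →
      ENNReal.ofReal |inner ℝ (parallelField α φ (p.2 + α)) (U p) -
        inner ℝ (parallelField α φ p.2) (U p)| ≤
      ∫⁻ t in Ioc (0 : ℝ) α, frameSize α (p.2 + t) (V (p + (0, t))) := fun φ => by
    filter_upwards [(hw φ).ae_sub_eq_integral hα0.le] with p hp hps
    have h1 := hp hps
    simp only [hper, Prod.snd_add] at h1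
    rw [h1, ← Real.norm_eq_abs, ofReal_norm, intervalIntegral.integral_of_le hα0.le]
    exact (enorm_integral_le_lintegral_enorm _).trans
      (lintegral_mono fun t => enorm_inner_parallelField_le _ _ _ _)
  filter_upwards [htan, hle 0, hle (-(Real.pi / 2))] with p ht h0 h1 hps
  refine (ENNReal.ofReal_le_ofReal (holonomy_le hα0 hα1 (ht hps))).trans ?_
  rw [ENNReal.ofReal_add (abs_nonneg _) (abs_nonneg _), two_mul]
  exact add_le_add (h0 hps) (h1 hps)

theorem aemeasurable_frameSize {α : ℝ} {V : ℝ × ℝ → E3} (hV : LocallyIntegrableOn V strip) :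
    AEMeasurable (fun p => frameSize α p.2 (V p)) (volume.restrict strip) := by
  have hm : AEStronglyMeasurable V (volume.restrict strip) := hV.aestronglyMeasurable
  have hg : AEStronglyMeasurable (fun p : ℝ × ℝ => generatorField α p.2) (volume.restrict strip) :=
    (continuous_generatorField.comp continuous_snd).aestronglyMeasurable
  have hl : AEStronglyMeasurable (fun p : ℝ × ℝ => latitudeField α p.2) (volume.restrict strip) :=
    (continuous_latitudeField.comp continuous_snd).aestronglyMeasurable
  exact (hg.inner (𝕜 := ℝ) hm).enorm.add (hl.inner (𝕜 := ℝ) hm).enorm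

/-- The arcs leave the period on which the energy is measured; periodicity of `V` brings them back
to it. -/
theorem IsWeakDeriv.ae_periodic {a : ℝ} {U V : ℝ × ℝ → E3} (hUV : IsWeakDeriv (0, 1) U V)
    (hper : ∀ p, U (p + (0, a)) = U p) :
    ∀ᵐ p : ℝ × ℝ, p ∈ strip → V (p + (0, a)) = V p := by
  have h : ∀ᵐ p : ℝ × ℝ, ∀ i, p ∈ strip → V (p + (0, a)) i = V p i := ae_all_iff.2 fun i =>
    (hUV.isWeakAngularDeriv i).ae_periodic fun p => by rw [hper]
  filter_upwards [h] with p hp hps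
  ext i
  exact hp i hps

theorem mainTheorem9 (α : ℝ) (hα0 : 0 < α) (hα1 : α < 2 * Real.pi)
    (s : ℝ) (hs : 1 / 2 < s) (g : E3 → E3) (hg : MemHsUnitTangent α s g)
    (u : E3 → E3) (hu : u ∈ H1g α g) (r : ℝ) (hr : 0 < r) :
    ¬ ∃ γ : ℝ, 0 < γ ∧ ∀ᵐ x ∂coneMeasure α, x ∈ coneBall α 0 r → γ ≤ ‖u x‖ := by
  rintro ⟨γ, hγ0, hγ⟩
  obtain ⟨⟨htan, -, Ur, V, -, hUV, henergy⟩, -⟩ := hu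
  set U := u ∘ conePoint α with hU
  have hper : ∀ p, U (p + (0, α)) = U p := fun p => by
    simp only [hU, Function.comp_apply, conePoint_add_period hα0.ne']
  have htan' : ∀ᵐ p : ℝ × ℝ, p ∈ strip →
      U p ∈ Submodule.span ℝ {generatorField α p.2, latitudeField α p.2} := by
    have h1 := ae_strip_of_periodic hα0 (P := fun p => U p ∈ coneTangentSpace (conePoint α p))
      (fun p => by rw [hper, conePoint_add_period hα0.ne']) (ae_polar_of_ae_coneMeasure htan)
    filter_upwards [h1] with p hp hps
    rw [← coneTangentSpace_conePoint hα0 hα1 hps.1.1]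
    exact hp hps
  -- The holonomy is nontrivial exactly because `α` lies strictly between `0` and `2π`; a flat disc
  -- would have `α = 2π`.
  have hcos : 0 < 2 - 2 * Real.cos α := by
    have hne : Real.cos α ≠ 1 := fun h =>
      hα0.ne' ((Real.cos_eq_one_iff_of_lt_of_lt (by linarith) hα1).1 h)
    have := lt_of_le_of_ne (Real.cos_le_one α) hne
    linarith
  have hr₀ : 0 < min r 1 := lt_min hr one_pos
  have hsub : Ioo (0 : ℝ) 1 ×ˢ Ioo (0 : ℝ) α ⊆ strip := prod_mono_right (subset_univ _)
  have hlow : ∀ᵐ p : ℝ × ℝ, p ∈ Ioo (0 : ℝ) (min r 1) ×ˢ Ioo (0 : ℝ) α →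
      ENNReal.ofReal (√(2 - 2 * Real.cos α) * γ / 2) ≤
        ∫⁻ t in Ioc (0 : ℝ) α, frameSize α (p + (0, t)).2 (V (p + (0, t))) := by
    filter_upwards [ae_holonomy_le_arc hα0 hα1 hUV hper htan', ae_polar_of_ae_coneMeasure hγ]
      with p h1 h2 hp
    have hp1 : p.1 < 1 := hp.1.2.trans_le (min_le_right _ _)
    have h3 : γ ≤ ‖U p‖ := h2 ⟨⟨hp.1.1, hp1⟩, hp.2⟩
      (conePoint_mem_coneBall hα0 hα1 hp.1.1 hp1.le (hp.1.2.trans_le (min_le_left _ _)) p.2)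
    have h4 := (ENNReal.ofReal_le_ofReal (mul_le_mul_of_nonneg_left h3
      (Real.sqrt_nonneg (2 - 2 * Real.cos α)))).trans (h1 ⟨⟨hp.1.1, hp1⟩, mem_univ _⟩)
    rw [ENNReal.ofReal_div_of_pos two_pos]
    exact ENNReal.div_le_of_le_mul' (by simpa using h4)
  have htop := lintegral_energy_eq_top (k := fun p => frameSize α p.2 (V p)) hα0
    (c := √(2 - 2 * Real.cos α) * γ / 2) (by positivity) hr₀ (min_le_right _ _)
    ((aemeasurable_frameSize hUV.2.1).mono_measure (Measure.restrict_mono hsub le_rfl))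
    ((hUV.ae_periodic hper).mono fun p hp hps => by
      simp only [hp hps, frameSize, Prod.snd_add, generatorField_add_period hα0.ne',
        latitudeField_add_period hα0.ne'])
    hlow
  have hfin : ∫⁻ p in Ioo (0 : ℝ) 1 ×ˢ Ioo (0 : ℝ) α,
      4 * ENNReal.ofReal (covDerivNormSq α p (Ur p) (V p) * p.1) < ⊤ := by
    rw [lintegral_const_mul' _ _ (by norm_num)]
    exact ENNReal.mul_lt_top (by norm_num) henergy
  refine hfin.ne (top_le_iff.1 (htop.symm.le.trans ?_))
  exact setLIntegral_mono' (measurableSet_Ioo.prod measurableSet_Ioo) fun p hp =>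
    frameSize_sq_le_covDerivNormSq hα0 hα1 hp.1.1 _ _
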